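/- Let $R$ be a commutative ring with unity, with Jacobson radical $J(R)$. An $R$-module $M$ is called simple-direct-injective if every simple submodule of $M$ that is isomorphic to a direct summand of $M$ is itself a direct summand of $M$; it is called simple-direct-projective if, whenever $A$ and $B$ are submodules of $M$ such that $B$ is simple, $B$ is a direct summand of $M$ and $M/A \cong B$, then $A$ is a direct summand of $M$. The ring $R$ is called perfect if $R/J(R)$ is a semisimple ring and $J(R)$ is T-nilpotent, i.e. for every sequence $a_1, a_2, \dots$ in $J(R)$ there is an $n \geq 1$ with $a_1 a_2 \cdots a_n = 0$. The following statements are equivalent: 1. $R$ is a perfect ring. 2. Every simple-direct-injective $R$-module is simple-direct-projective. -/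

import Mathlib

universe u v

/-- A subset `A` of a commutative ring is T-nilpotent if for every sequence `a₀, a₁, a₂, …` of
elements of `A` some finite initial product `a₀ a₁ ⋯ aₙ₋₁` vanishes. -/
def IsTNilpotent {R : Type*} [CommRing R] (A : Set R) : Prop :=
  ∀ a : ℕ → R, (∀ i, a i ∈ A) → ∃ n : ℕ, ∏ i ∈ Finset.range n, a i = 0

/-- A commutative ring `R` is perfect (in the sense of Bass) if `R / J(R)` is semisimple and
the Jacobson radical `J(R)` is T-nilpotent. (For commutative rings left and right perfectness
coincide. This is unrelated to Mathlib's `PerfectRing`, which is about the Frobenius map.) -/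
structure IsBassPerfectRing (R : Type*) [CommRing R] : Prop where
  isSemisimpleRing : IsSemisimpleRing (R ⧸ Ring.jacobson R)
  isTNilpotent : IsTNilpotent (Ring.jacobson R : Set R)

/-- A module `M` is simple-direct-injective if every simple submodule `A` of `M` that is
isomorphic to a direct summand `B` of `M` is itself a direct summand of `M`.
(`IsComplemented N` says that `N` has a complement in the lattice of submodules,
that is, `N` is a direct summand.) -/
def IsSimpleDirectInjective (R M : Type*) [Ring R] [AddCommGroup M] [Module R M] : Prop :=
  ∀ A B : Submodule R M, IsSimpleModule R A → Nonempty (A ≃ₗ[R] B) →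
    IsComplemented B → IsComplemented A

/-- A module `M` is simple-direct-projective if, whenever `A` and `B` are submodules of `M` with
`B` simple, `M / A ≅ B` and `B` a direct summand of `M`, then `A` is a direct summand of `M`. -/
def IsSimpleDirectProjective (R M : Type*) [Ring R] [AddCommGroup M] [Module R M] : Prop :=
  ∀ A B : Submodule R M, IsSimpleModule R B → Nonempty ((M ⧸ A) ≃ₗ[R] B) →
    IsComplemented B → IsComplemented A

/-! Perfect rings: let `M ⧸ A` be isomorphic to a simple summand `R ⧸ m`. Lift an idempotent to get
`e`, and take `e • x` outside `A`. T-nilpotence yields a nonzero multiple of it spanning a copy of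
`R ⧸ m`. Either this is `e • x` itself, and the span complements `A`, or it lies in `J(R) M`; it is
then killed by every map to a simple module, so its span cannot be a summand. Conversely, if all
simple submodules of `N` are summands, then `S × N` is simple-direct-injective for simple `S`. The
hypothesis then says that `N` maps nontrivially to `S` only if `S` embeds in `N`
(`exists_hom_ne_zero_of_hom_ne_zero`). Cyclic `N` without simple submodules are thereby excluded,
giving T-nilpotence; `N = R ⧸ J(R)` gives semisimplicity. -/

theorem isComplemented_of_retraction {R M : Type*} [Ring R] [AddCommGroup M] [Module R M]
    {A : Submodule R M} (f : M →ₗ[R] A) (hf : ∀ x : A, f x = x) : IsComplemented A :=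
  ⟨_, LinearMap.isCompl_of_proj hf⟩

theorem IsComplemented.exists_retraction {R M : Type*} [Ring R] [AddCommGroup M] [Module R M]
    {A : Submodule R M} (h : IsComplemented A) : ∃ f : M →ₗ[R] A, ∀ x : A, f x = x :=
  let ⟨q, hq⟩ := h
  let f := A.isComplEquivProj ⟨q, hq⟩
  ⟨f.1, f.2⟩

theorem isComplemented_of_map_equiv {R M N : Type*} [Ring R] [AddCommGroup M] [Module R M]
    [AddCommGroup N] [Module R N] (e : M ≃ₗ[R] N) {A : Submodule R M}
    (h : IsComplemented (A.map e.toLinearMap)) : IsComplemented A := by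
  obtain ⟨f, hf⟩ := h.exists_retraction
  refine isComplemented_of_retraction ((e.submoduleMap A).symm.toLinearMap ∘ₗ f ∘ₗ e.toLinearMap) ?_
  intro x
  have h1 : f (e x) = e.submoduleMap A x := hf (e.submoduleMap A x)
  simp [h1]

/-- A simple submodule that is not contained in a maximal submodule is a complement of it. -/
theorem isComplemented_of_simple_not_le {R M : Type*} [Ring R] [AddCommGroup M] [Module R M]
    {A T : Submodule R M} (hA : IsCoatom A) [IsSimpleModule R T] (h : ¬ T ≤ A) :
    IsComplemented A := by
  have hT : IsAtom T := isSimpleModule_iff_isAtom.1 inferInstance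
  refine ⟨T, ((IsAtom.not_le_iff_disjoint hT).1 h).symm, codisjoint_iff.2 ?_⟩
  exact hA.2 _ (left_lt_sup.2 h)

/-- Over a T-nilpotent set, every nonzero vector has a nonzero multiple that is killed by the
set, and this multiple can be taken divisible by an element of the set unless it is the vector. -/
theorem IsTNilpotent.exists_smul_eq_zero {R M : Type*} [CommRing R] [AddCommGroup M] [Module R M]
    {A : Set R} (hA : IsTNilpotent A) {x : M} (hx : x ≠ 0) :
    ∃ r : R, r • x ≠ 0 ∧ (∀ a ∈ A, a • r • x = 0) ∧
      (r • x = x ∨ ∃ a ∈ A, ∃ z : M, r • x = a • z) := by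
  by_contra! H
  let P := {y : M // y ≠ 0 ∧ (∃ r : R, y = r • x) ∧ (y = x ∨ ∃ a ∈ A, ∃ z : M, y = a • z)}
  have key : ∀ p : P, ∃ a ∈ A, a • p.1 ≠ 0 := by
    rintro ⟨y, hy, ⟨r, rfl⟩, h⟩
    by_contra! h2
    obtain ⟨h3, h4⟩ := H r hy h2
    rcases h with h | ⟨a, ha, z, h⟩
    · exact h3 h
    · exact h4 a ha z h
  choose a haA ha using key
  let next : P → P := fun p ↦ ⟨a p • p.1, ha p,
    let ⟨r, hr⟩ := p.2.2.1
    ⟨a p * r, by rw [mul_smul, ← hr]⟩, .inr ⟨a p, haA p, p.1, rfl⟩⟩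
  let p : ℕ → P := fun n ↦ next^[n] ⟨x, hx, ⟨1, (one_smul R x).symm⟩, .inl rfl⟩
  have hp : ∀ n, (p n).1 = (∏ i ∈ Finset.range n, a (p i)) • x := by
    intro n
    induction n with
    | zero => simp [p]
    | succ n ih =>
      have : p (n + 1) = next (p n) := Function.iterate_succ_apply' _ _ _
      rw [this, Finset.prod_range_succ, mul_comm, mul_smul, ← ih]
  obtain ⟨n, hn⟩ := hA (fun i ↦ a (p i)) fun i ↦ haA _
  exact (p n).2.1 (by rw [hp, hn, zero_smul])

theorem IsTNilpotent.isNilpotent {R : Type*} [CommRing R] {A : Set R} (hA : IsTNilpotent A)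
    {x : R} (hx : x ∈ A) : IsNilpotent x := by
  obtain ⟨n, hn⟩ := hA (fun _ ↦ x) fun _ ↦ hx
  exact ⟨n, by simpa using hn⟩

/-- Over a perfect ring, each maximal ideal has an idempotent which is `1` modulo the ideal and
multiplies the ideal into the Jacobson radical. -/
theorem IsBassPerfectRing.exists_idempotent {R : Type*} [CommRing R] (hR : IsBassPerfectRing R)
    (m : Ideal R) [m.IsMaximal] :
    ∃ e : R, e * e = e ∧ 1 - e ∈ m ∧ ∀ r ∈ m, r * e ∈ Ring.jacobson R := by
  have := hR.isSemisimpleRing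
  obtain ⟨i, hi, hmi⟩ := IsSemisimpleRing.ideal_eq_span_idempotent
    (m.map (Ideal.Quotient.mk (Ring.jacobson R)))
  obtain ⟨f, hf, rfl⟩ := exists_isIdempotentElem_eq_of_ker_isNilpotent
    (Ideal.Quotient.mk (Ring.jacobson R))
    (fun x hx ↦ hR.isTNilpotent.isNilpotent (by simpa [Ideal.mk_ker] using hx)) i
    (Ideal.Quotient.mk_surjective i) hi
  refine ⟨1 - f, hf.one_sub, ?_, fun r hr ↦ ?_⟩
  · have h1 : Ideal.Quotient.mk (Ring.jacobson R) f ∈ m.map (Ideal.Quotient.mk _) := by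
      rw [hmi]; exact Ideal.mem_span_singleton_self _
    rw [sub_sub_cancel]
    have h2 := Ideal.mem_comap.2 h1
    rwa [Ideal.comap_map_of_surjective _ Ideal.Quotient.mk_surjective, ← RingHom.ker_eq_comap_bot,
      Ideal.mk_ker, sup_eq_left.2 (Ring.jacobson_le_of_isMaximal m)] at h2
  · have h1 := Ideal.mem_map_of_mem (Ideal.Quotient.mk (Ring.jacobson R)) hr
    rw [hmi, Ideal.mem_span_singleton] at h1
    obtain ⟨c, hc⟩ := h1
    rw [← Ideal.Quotient.eq_zero_iff_mem, map_mul, hc, map_sub, map_one, mul_right_comm,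
      mul_one_sub, hi.eq, sub_self, zero_mul]

theorem linearEquiv_span_singleton_of_isMaximal {R M : Type*} [CommRing R] [AddCommGroup M]
    [Module R M] {m : Ideal R} (hm : m.IsMaximal) {y : M} (hy : y ≠ 0)
    (hmy : ∀ r ∈ m, r • y = 0) : Nonempty (Submodule.span R {y} ≃ₗ[R] R ⧸ m) := by
  have hker : LinearMap.ker (LinearMap.toSpanSingleton R M y) = m := by
    symm
    refine hm.eq_of_le ?_ fun r hr ↦ by simpa using hmy r hr
    intro h
    have h1 : (1 : R) ∈ LinearMap.ker (LinearMap.toSpanSingleton R M y) := by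
      rw [h]; exact Submodule.mem_top
    exact hy (by simpa using h1)
  exact ⟨(LinearEquiv.ofEq _ _ (LinearMap.range_toSpanSingleton y).symm).trans
    ((LinearMap.quotKerEquivRange _).symm.trans (Submodule.quotEquivOfEq _ _ hker))⟩

theorem IsBassPerfectRing.isSimpleDirectProjective {R M : Type*} [CommRing R] [AddCommGroup M]
    [Module R M] (hR : IsBassPerfectRing R) (hM : IsSimpleDirectInjective R M) :
    IsSimpleDirectProjective R M := by
  rintro A B hB ⟨φ⟩ hBc
  have hAc : IsCoatom A := by
    rw [← isSimpleModule_iff_isCoatom]; exact .congr φ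
  obtain ⟨m, hm, ⟨ψ⟩⟩ := isSimpleModule_iff_quot_maximal.1 hB
  obtain ⟨e, he, hem, heJ⟩ := hR.exists_idempotent m
  have hmA : ∀ r ∈ m, ∀ x : M, r • x ∈ A := by
    intro r hr x
    have h1 : r • (φ.trans ψ) (A.mkQ x) = 0 := by
      obtain ⟨s, hs⟩ := Ideal.Quotient.mk_surjective ((φ.trans ψ) (A.mkQ x))
      rw [← hs, ← Ideal.Quotient.mk_eq_mk, ← Submodule.Quotient.mk_smul,
        Submodule.Quotient.mk_eq_zero]
      exact m.mul_mem_right s hr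
    rw [← map_smul, LinearEquiv.map_eq_zero_iff, ← map_smul] at h1
    exact (Submodule.Quotient.mk_eq_zero A).1 h1
  obtain ⟨x, -, hx⟩ := SetLike.exists_of_lt hAc.lt_top
  have hex : e • x ∉ A := fun h ↦ hx (by
    simpa [sub_smul] using A.add_mem (hmA _ hem x) h)
  have hfix : ∀ r : R, e • r • e • x = r • e • x := fun r ↦ by
    rw [smul_comm, ← mul_smul e e, he]
  obtain ⟨r, hr0, hrJ, hr⟩ := hR.isTNilpotent.exists_smul_eq_zero
    (x := e • x) fun h ↦ hex (h ▸ A.zero_mem)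
  -- Since `e` fixes this vector, `s` acts on it as `s * e`, which lies in the radical.
  have hmy : ∀ s ∈ m, s • r • e • x = 0 := fun s hs ↦ by
    rw [← hfix, ← mul_smul]; exact hrJ _ (heJ s hs)
  obtain ⟨χ⟩ := linearEquiv_span_singleton_of_isMaximal hm hr0 hmy
  have hsimple : IsSimpleModule R (Submodule.span R {r • e • x}) := .congr (χ.trans ψ.symm)
  rcases hr with hr | ⟨a, ha, z, hz⟩
  · exact isComplemented_of_simple_not_le hAc fun h ↦
      hex (hr ▸ h (Submodule.mem_span_singleton_self _))
  · obtain ⟨f, hf⟩ := (hM _ B hsimple ⟨χ.trans ψ.symm⟩ hBc).exists_retraction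
    have h1 := hf ⟨_, Submodule.mem_span_singleton_self _⟩
    have h2 : a • f z = 0 := by
      obtain ⟨c, hc⟩ := Submodule.mem_span_singleton.1 (f z).2
      ext
      rw [Submodule.coe_smul, ← hc, smul_comm,
        hmy a (Ring.jacobson_le_of_isMaximal m ha), smul_zero, Submodule.coe_zero]
    have h3 : f (r • e • x) = 0 := (congrArg f hz).trans (by rw [map_smul, h2])
    exact absurd (congrArg Subtype.val (h1.symm.trans h3)) hr0

/-! ### The converse: perfectness from the module condition. -/

section Converse

/-- If every simple submodule of `N` is a direct summand, then so is every simple submodule of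
`S × N` with `S` simple. -/
theorem isComplemented_of_isSimpleModule_prod {R S N : Type*} [Ring R] [AddCommGroup S]
    [Module R S] [IsSimpleModule R S] [AddCommGroup N] [Module R N]
    (hN : ∀ T : Submodule R N, IsSimpleModule R T → IsComplemented T)
    (A : Submodule R (S × N)) [IsSimpleModule R A] : IsComplemented A := by
  rcases LinearMap.bijective_or_eq_zero (LinearMap.fst R S N ∘ₗ A.subtype) with h | h
  · let e := LinearEquiv.ofBijective _ h
    exact isComplemented_of_retraction (e.symm.toLinearMap ∘ₗ LinearMap.fst R S N)
      fun x ↦ e.symm_apply_apply x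
  · have h0 : ∀ x : A, x.1.1 = 0 := fun x ↦ LinearMap.congr_fun h x
    have hinj : Function.Injective (LinearMap.snd R S N ∘ₗ A.subtype) := by
      rw [injective_iff_map_eq_zero]
      intro x hx
      exact Subtype.ext (Prod.ext (h0 x) hx)
    let e := LinearEquiv.ofInjective _ hinj
    obtain ⟨f, hf⟩ := (hN _ (IsSimpleModule.congr e.symm)).exists_retraction
    refine isComplemented_of_retraction (e.symm.toLinearMap ∘ₗ f ∘ₗ LinearMap.snd R S N) fun x ↦ ?_
    have h1 : f x.1.2 = e x := hf (e x)
    simp [h1]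

/-- If `g ≠ 0`, the kernel of `g ∘ snd` has a complement isomorphic to `S`. With no nonzero map from
`S` to `N`, this complement lies in `S × 0`, hence inside the kernel. -/
theorem eq_zero_of_hom_eq_zero {R S N : Type*} [Ring R] [AddCommGroup S]
    [Module R S] [IsSimpleModule R S] [AddCommGroup N] [Module R N]
    (h : IsSimpleDirectProjective R (S × N)) (hS : ∀ f : S →ₗ[R] N, f = 0) (g : N →ₗ[R] S) :
    g = 0 := by
  by_contra hg
  have hsurj : Function.Surjective (g ∘ₗ LinearMap.snd R S N) :=
    (LinearMap.surjective_of_ne_zero hg).comp Prod.snd_surjective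
  let e : S ≃ₗ[R] LinearMap.range (LinearMap.inl R S N) :=
    LinearEquiv.ofInjective _ LinearMap.inl_injective
  let φ := (g ∘ₗ LinearMap.snd R S N).quotKerEquivOfSurjective hsurj
  obtain ⟨C, hC⟩ := h _ _ (IsSimpleModule.congr e.symm) ⟨φ.trans e⟩
    ⟨_, LinearMap.isCompl_range_inl_inr⟩
  let ψ : S ≃ₗ[R] C := φ.symm.trans (Submodule.quotientEquivOfIsCompl _ C hC)
  have hle : C ≤ LinearMap.ker (g ∘ₗ LinearMap.snd R S N) := by
    intro x hx
    have h1 := LinearMap.congr_fun (hS (LinearMap.snd R S N ∘ₗ C.subtype ∘ₗ ψ.toLinearMap))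
      (ψ.symm ⟨x, hx⟩)
    have h2 : x.2 = 0 := by simpa using h1
    simp [h2]
  have hbot : C = ⊥ := hC.disjoint.eq_bot_of_ge hle
  have := IsSimpleModule.nontrivial R S
  obtain ⟨s, hs⟩ := exists_ne (0 : S)
  refine hs (ψ.injective (Subtype.ext ?_))
  have h3 : (ψ s : S × N) ∈ (⊥ : Submodule R (S × N)) := hbot ▸ (ψ s).2
  rw [map_zero]
  simpa using h3

variable {R : Type u} [CommRing R]

/-- If simple-direct-injective modules are simple-direct-projective, then a module whose simple
submodules are all direct summands embeds every simple module that it maps onto. -/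
theorem exists_hom_ne_zero_of_hom_ne_zero
    (H : ∀ (M : Type (max u v)) [AddCommGroup M] [Module R M],
      IsSimpleDirectInjective R M → IsSimpleDirectProjective R M)
    {N : Type u} [AddCommGroup N] [Module R N]
    (hN : ∀ T : Submodule R N, IsSimpleModule R T → IsComplemented T)
    {m : Ideal R} (hm : m.IsMaximal) {g : N →ₗ[R] R ⧸ m} (hg : g ≠ 0) :
    ∃ f : R ⧸ m →ₗ[R] N, f ≠ 0 := by
  by_contra! hf
  have : IsSimpleModule R (R ⧸ m) := isSimpleModule_iff_isCoatom.2 hm.out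
  -- `H` speaks of modules in `max u v`, so `N` is lifted there.
  let e : ULift.{v} N ≃ₗ[R] N := ULift.moduleEquiv
  have hN' : ∀ T : Submodule R (ULift.{v} N), IsSimpleModule R T → IsComplemented T :=
    fun T hT ↦ isComplemented_of_map_equiv e (hN _ (.congr (e.submoduleMap T).symm))
  have h1 := eq_zero_of_hom_eq_zero (S := R ⧸ m) (N := ULift.{v} N)
    (H _ fun A _ _ _ _ ↦ isComplemented_of_isSimpleModule_prod hN' A)
    (fun f ↦ by
      refine LinearMap.ext fun x ↦ e.injective ?_
      simpa using LinearMap.congr_fun (hf (e.toLinearMap ∘ₗ f)) x)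
    (g ∘ₗ e.toLinearMap)
  refine hg (LinearMap.ext fun x ↦ ?_)
  simpa using LinearMap.congr_fun h1 (e.symm x)

theorem factor_ne_zero {I m : Ideal R} (h : I ≤ m) (hm : m.IsMaximal) :
    Submodule.factor h ≠ 0 := fun h0 ↦ by
  have h1 : Submodule.factor h (I.mkQ 1) = 0 := by rw [h0, LinearMap.zero_apply]
  exact hm.ne_top ((Ideal.eq_top_iff_one m).2 ((Submodule.Quotient.mk_eq_zero m).1 h1))

theorem exists_simple_submodule_quotient
    (H : ∀ (M : Type (max u v)) [AddCommGroup M] [Module R M],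
      IsSimpleDirectInjective R M → IsSimpleDirectProjective R M)
    {I : Ideal R} (hI : I ≠ ⊤) : ∃ T : Submodule R (R ⧸ I), IsSimpleModule R T := by
  by_contra! hT
  obtain ⟨m, hm, hIm⟩ := I.exists_le_maximal hI
  obtain ⟨f, hf⟩ := exists_hom_ne_zero_of_hom_ne_zero H (fun T h ↦ absurd h (hT T)) hm
    (factor_ne_zero hIm hm)
  have : IsSimpleModule R (R ⧸ m) := isSimpleModule_iff_isCoatom.2 hm.out
  exact hT _ (.congr (LinearEquiv.ofInjective f (LinearMap.injective_of_ne_zero hf)).symm)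

/-- Take an ideal `I` maximal among those avoiding all initial products. A simple submodule of `R ⧸
I` pulls back to a larger ideal, which contains a product; the next factor kills the simple module,
putting the next product in `I`. -/
theorem isTNilpotent_jacobson_of_exists_simple_submodule
    (hR : ∀ I : Ideal R, I ≠ ⊤ → ∃ T : Submodule R (R ⧸ I), IsSimpleModule R T) :
    IsTNilpotent (Ring.jacobson R : Set R) := by
  intro a ha
  by_contra! hn
  obtain ⟨I, -, hI⟩ := zorn_le_nonempty₀
    {I : Ideal R | ∀ n, ∏ i ∈ Finset.range n, a i ∉ I} (fun c hc hchain y hy ↦ by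
      refine ⟨sSup c, fun n h ↦ ?_, fun z hz ↦ le_sSup hz⟩
      obtain ⟨J, hJ, hJn⟩ := (Submodule.mem_sSup_of_directed ⟨y, hy⟩ hchain.directedOn).1 h
      exact hc hJ n hJn) ⊥ (fun n ↦ by simpa using hn n)
  obtain ⟨T, hT⟩ := hR I fun h ↦ hI.prop 0 (h ▸ Submodule.mem_top)
  have hlt : I < T.comap I.mkQ := by
    refine lt_of_le_of_ne (I.le_comap_mkQ T) fun h ↦ ?_
    have hb : T = ⊥ := by
      rw [← Submodule.map_comap_eq_of_surjective I.mkQ_surjective T, ← h, Submodule.mkQ_map_self]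
    exact (isSimpleModule_iff_isAtom.1 hT).1 hb
  have h1 : ∃ n, ∏ i ∈ Finset.range n, a i ∈ T.comap I.mkQ := by
    by_contra! h
    exact hlt.not_ge (hI.le_of_ge h hlt.le)
  obtain ⟨n, hn⟩ := h1
  refine hI.prop (n + 1) ?_
  have hann : a n ∈ Module.annihilator R T := by
    have := IsSimpleModule.annihilator_isMaximal (R := R) (M := T)
    exact Ring.jacobson_le_of_isMaximal _ (ha n)
  have h2 := congrArg Subtype.val (Module.mem_annihilator.1 hann ⟨_, hn⟩)
  rw [Finset.prod_range_succ, mul_comm, ← Submodule.Quotient.mk_eq_zero]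
  exact h2

theorem mem_jacobson_of_mul_self_mem {x : R} (hx : x * x ∈ Ring.jacobson R) :
    x ∈ Ring.jacobson R := by
  rw [Ring.jacobson_eq_sInf_isMaximal] at hx ⊢
  simp only [Submodule.mem_sInf, Set.mem_ofPred_eq] at hx ⊢
  exact fun m hm ↦ (hm.isPrime.mem_or_mem (hx m hm)).elim id id

/-- Minimal ideals of `R ⧸ J(R)` are direct summands. -/
theorem isComplemented_of_isSimpleModule_quotient_jacobson
    (T : Submodule R (R ⧸ Ring.jacobson R)) [IsSimpleModule R T] : IsComplemented T := by
  have := IsSimpleModule.nontrivial R T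
  obtain ⟨⟨y, hyT⟩, hy⟩ := exists_ne (0 : T)
  obtain ⟨x, rfl⟩ := Submodule.mkQ_surjective _ y
  have hne : x • (⟨_, hyT⟩ : T) ≠ 0 := fun h ↦ hy (Subtype.ext (by
    have h1 := congrArg Subtype.val h
    have h2 : x * x ∈ Ring.jacobson R := (Submodule.Quotient.mk_eq_zero _).1 h1
    exact (Submodule.Quotient.mk_eq_zero _).2 (mem_jacobson_of_mul_self_mem h2)))
  -- `r * x` fixes the generator of `T`, so multiplication by it is a retraction onto `T`.
  obtain ⟨r, hr⟩ := IsSimpleModule.toSpanSingleton_surjective R hne ⟨_, hyT⟩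
  have hfix : ∀ t : T, (r * x) • t = t := by
    intro t
    obtain ⟨s, rfl⟩ := IsSimpleModule.toSpanSingleton_surjective R hy t
    rw [LinearMap.toSpanSingleton_apply, smul_comm, mul_smul]
    exact congrArg (s • ·) hr
  refine isComplemented_of_retraction
    (LinearMap.codRestrict T (LinearMap.lsmul R (R ⧸ Ring.jacobson R) (r * x)) fun z ↦ ?_) ?_
  · obtain ⟨z, rfl⟩ := Submodule.mkQ_surjective _ z
    have h1 := T.smul_mem (z * r) hyT
    rw [← map_smul] at h1
    rw [LinearMap.lsmul_apply, ← map_smul]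
    convert h1 using 2
    simp only [smul_eq_mul]
    ring
  · exact fun t ↦ Subtype.ext (congrArg Subtype.val (hfix t))

theorem isSemisimpleRing_quotient_jacobson
    (hR : ∀ m : Ideal R, m.IsMaximal → ∃ f : R ⧸ m →ₗ[R] R ⧸ Ring.jacobson R, f ≠ 0) :
    IsSemisimpleRing (R ⧸ Ring.jacobson R) := by
  have hss : IsSemisimpleModule R (R ⧸ Ring.jacobson R) := by
    refine .of_sSup_simples_eq_top ?_
    set K := sSup {T : Submodule R (R ⧸ Ring.jacobson R) | IsSimpleModule R T}
    by_contra hK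
    have hI : K.comap (Ring.jacobson R).mkQ ≠ ⊤ := fun h ↦ hK (by
      rw [← Submodule.map_comap_eq_of_surjective (Ring.jacobson R).mkQ_surjective K, h,
        Submodule.map_top, Submodule.range_mkQ])
    obtain ⟨m, hm, hIm⟩ := Ideal.exists_le_maximal _ hI
    obtain ⟨f, hf⟩ := hR m hm
    have : IsSimpleModule R (R ⧸ m) := isSimpleModule_iff_isCoatom.2 hm.out
    have hT : LinearMap.range f ≤ K := le_sSup (IsSimpleModule.congr
      (LinearEquiv.ofInjective f (LinearMap.injective_of_ne_zero hf)).symm)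
    -- The image of `1` lies in the socle `K`, so its lift `x` is in `m` and kills that image: `x *
    -- x` is in the radical, which forces `f = 0`.
    obtain ⟨x, hx⟩ := (Ring.jacobson R).mkQ_surjective (f (m.mkQ 1))
    have hxm : x ∈ m := hIm (by
      rw [Submodule.mem_comap, hx]; exact hT (LinearMap.mem_range_self _ _))
    have h1 : x • m.mkQ 1 = 0 := by
      rw [← map_smul, smul_eq_mul, mul_one, Submodule.mkQ_apply, Submodule.Quotient.mk_eq_zero]
      exact hxm
    have h2 : x • (Ring.jacobson R).mkQ x = 0 := by rw [hx, ← map_smul, h1, map_zero]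
    have h3 : x ∈ Ring.jacobson R :=
      mem_jacobson_of_mul_self_mem ((Submodule.Quotient.mk_eq_zero _).1 h2)
    have h4 : f (m.mkQ 1) = 0 := by
      rw [← hx]; exact (Submodule.Quotient.mk_eq_zero _).2 h3
    refine hf (LinearMap.ext fun z ↦ ?_)
    obtain ⟨z, rfl⟩ := m.mkQ_surjective z
    rw [← mul_one z, ← smul_eq_mul, map_smul, map_smul, h4, smul_zero, LinearMap.zero_apply]
  -- The identity, semilinear along the quotient map, transfers semisimplicity from `R` to the
  -- quotient ring.
  let l : R ⧸ Ring.jacobson R →ₛₗ[Ideal.Quotient.mk (Ring.jacobson R)] R ⧸ Ring.jacobson R :=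
    { toFun := id
      map_add' := fun _ _ ↦ rfl
      map_smul' := fun r x ↦ Algebra.smul_def r x }
  have : RingHomSurjective (Ideal.Quotient.mk (Ring.jacobson R)) :=
    ⟨Ideal.Quotient.mk_surjective⟩
  exact (l.isSemisimpleModule_iff_of_bijective Function.bijective_id).1 hss

end Converse

theorem corollary4p3 (R : Type u) [CommRing R] :
    IsBassPerfectRing R ↔
      ∀ (M : Type (max u v)) [AddCommGroup M] [Module R M],
        IsSimpleDirectInjective R M → IsSimpleDirectProjective R M := by
  refine ⟨fun hR M _ _ hM ↦ hR.isSimpleDirectProjective hM, fun H ↦ ⟨?_, ?_⟩⟩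
  · exact isSemisimpleRing_quotient_jacobson fun m hm ↦ exists_hom_ne_zero_of_hom_ne_zero H
      (fun T _ ↦ isComplemented_of_isSimpleModule_quotient_jacobson T) hm
      (factor_ne_zero (Ring.jacobson_le_of_isMaximal m) hm)
  · exact isTNilpotent_jacobson_of_exists_simple_submodule
      fun I hI ↦ exists_simple_submodule_quotient H hI
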